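/- Let $\mathbb{X}$ be a compact topological space, let $X$ be an infinite-dimensional complex Banach space, and let $L(X)$ be the Banach algebra of bounded linear operators on $X$. Let $\mathcal{C}(\mathbb{X},L(X))$ be the unital algebra of continuous maps $\mathcal{T}:\mathbb{X}\to L(X)$, $x\mapsto\mathcal{T}_x$, with pointwise operations, unit $\mathcal{I}$ (the constant family with value the identity operator $I$), and the uniform norm $\|\mathcal{T}\|=\sup_{x\in\mathbb{X}}\|\mathcal{T}_x\|$; let $\sigma(\mathcal{T})$ denote the spectrum of $\mathcal{T}$ in this algebra. A family $\mathcal{T}\in\mathcal{C}(\mathbb{X},L(X))$ is a Fredholm family if every $\mathcal{T}_x$ is a Fredholm operator; its index is the family of integers, indexed by the connected components of $\mathbb{X}$, whose value at the component of $x$ is $\mathrm{ind}(\mathcal{T}_x)=\dim N(\mathcal{T}_x)-\mathrm{codim}\,R(\mathcal{T}_x)$. A Weyl family is a Fredholm family of index $0$, and the Weyl spectrum of $\mathcal{T}$ is $$\sigma_W(\mathcal{T})=\{\lambda\in\mathbb{C}:\ \mathcal{T}-\lambda\mathcal{I}\text{ is not a Weyl family}\}.$$ For subsets $A_n$ of $\mathbb{C}$,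 $\liminf_n A_n$ (resp. $\limsup_n A_n$) is the set of points each of whose neighbourhoods meets $A_n$ for all sufficiently large $n$ (resp. for infinitely many $n$), and $\lim_n A_n=A$ means $\liminf_n A_n=\limsup_n A_n=A$. Let $\mathcal{T}_n$ $(n\in\mathbb{N})$ and $\mathcal{T}$ be in $\mathcal{C}(\mathbb{X},L(X))$ with $\lim_{n\to\infty}\mathcal{T}_n=\mathcal{T}$. Then $\lim_{n\to\infty}\sigma_W(\mathcal{T}_n)=\sigma_W(\mathcal{T})$ in each of the following cases: 1. $\mathcal{T}_n\mathcal{T}=\mathcal{T}\mathcal{T}_n$ for each $n$; 2. $\sigma(\mathcal{T})$ is totally disconnected; 3. $X$ is a Hilbert space, and $\mathcal{T}_{n,x}$ (for every $n$) and $\mathcal{T}_x$ are normal operators for all $x\in\mathbb{X}$. -/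

import Mathlib

open Filter Topology

namespace OperatorFamily

variable {𝕏 X : Type*} [TopologicalSpace 𝕏] [NormedAddCommGroup X] [NormedSpace ℂ X]

/-- A continuous family of bounded operators is a Fredholm family if all its members are Fredholm
operators (continuity into the subspace of Fredholm operators is then automatic). -/
def IsFredholmFamily (T : C(𝕏, X →L[ℂ] X)) : Prop :=
  ∀ x : 𝕏, (T x).IsFredholm

/-- The integer family `p`, indexed by the connected components of the parameter space, is the
index of the family `T`: its value at the component of `x` is `ind (T x)`, where
`ind S = dim ker S - codim range S`. -/
def HasIndex (T : C(𝕏, X →L[ℂ] X)) (p : ConnectedComponents 𝕏 → ℤ) : Prop :=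
  ∀ x : 𝕏, (T x : X →ₗ[ℂ] X).index = p (ConnectedComponents.mk x)

/-- The index of a family is unique. -/
theorem HasIndex.unique {T : C(𝕏, X →L[ℂ] X)} {p q : ConnectedComponents 𝕏 → ℤ}
    (hp : HasIndex T p) (hq : HasIndex T q) : p = q := by
  funext c
  obtain ⟨x, rfl⟩ := ConnectedComponents.surjective_coe c
  exact (hp x).symm.trans (hq x)

/-- A Weyl family is a Fredholm family of index `0`. -/
def IsWeylFamily (T : C(𝕏, X →L[ℂ] X)) : Prop :=
  IsFredholmFamily T ∧ HasIndex T 0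

/-- The Weyl spectrum of a continuous family; here `1` is the constant family with value the
identity operator. -/
def weylSpectrum (T : C(𝕏, X →L[ℂ] X)) : Set ℂ :=
  {z : ℂ | ¬ IsWeylFamily (T - z • (1 : C(𝕏, X →L[ℂ] X)))}

/-- Kuratowski lower limit of a sequence of sets: the points each of whose neighbourhoods meets
`A n` for all sufficiently large `n`. -/
def setLiminf {Y : Type*} [TopologicalSpace Y] (A : ℕ → Set Y) : Set Y :=
  {y : Y | ∀ V ∈ 𝓝 y, ∀ᶠ n in atTop, (V ∩ A n).Nonempty}

/-- Kuratowski upper limit of a sequence of sets: the points each of whose neighbourhoods meets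
`A n` for infinitely many `n`. -/
def setLimsup {Y : Type*} [TopologicalSpace Y] (A : ℕ → Set Y) : Set Y :=
  {y : Y | ∀ V ∈ 𝓝 y, ∃ᶠ n in atTop, (V ∩ A n).Nonempty}

/-- `lim A n = B` in the sense of Kuratowski: lower and upper limit both equal `B`. -/
def SetTendsto {Y : Type*} [TopologicalSpace Y] (A : ℕ → Set Y) (B : Set Y) : Prop :=
  setLiminf A = B ∧ setLimsup A = B

end OperatorFamily

/-! Upper semicontinuity needs no extra hypothesis: index-zero Fredholm operators form an open set,
so, `𝕏` being compact, Weyl families form an open set (`setLimsup_weylSpectrum_subset`). The content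
is lower semicontinuity, which `setTendsto_weylSpectrum` reduces to single operators: if, for
infinitely many `n`, all `Tn n x - z` with `z` in a fixed ball about `y` are Weyl, then `T x - y` is
Weyl.

By Atkinson's theorem, Fredholm means invertible in the Banach algebra of operators modulo the
closure of the finite rank ones, so each case becomes a question about invertibility there, plus an
index argument. Commuting case: a commuting perturbation smaller than the distance to the spectrum
keeps invertibility, so the segment from `Tn n x - y` to `T x - y` is Fredholm and the index stays
zero. Totally disconnected case: the maximum principle bounds the resolvent of `Tn n x` at `y` by
its values on a small contour missing the limit spectrum (Newburgh's argument); index zero follows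
from invertible translates arbitrarily near `y`. Normal case: the quotient norm of a normal class is
at most its spectral radius, so the inverse of `Tn n x - y` has norm at most the reciprocal of the
radius of the ball; normal Fredholm operators have index zero. -/

/-! ### Index of finite rank perturbations of the identity. -/

namespace LinearMap

variable {k M : Type*} [Field k] [AddCommGroup M] [Module k M]

open Module in
/-- The identity plus a finite rank endomorphism has index zero. -/
theorem index_id_add_of_hasFiniteRange {f : M →ₗ[k] M} (hf : f.HasFiniteRange) :
    (LinearMap.id + f).index = 0 := by
  set g : M →ₗ[k] M := LinearMap.id + f with hg
  have hgx : ∀ x, g x = x + f x := fun x => rfl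
  have : FiniteDimensional k f.range := Module.Finite.of_fg hf
  have hmaps : ∀ x ∈ f.range, g x ∈ f.range := fun x hx =>
    f.range.add_mem hx ⟨x, rfl⟩
  -- Kernel and cokernel of `g` are those of its restriction to the finite-dimensional range of `f`,
  -- where the index vanishes by dimension count.
  let r : f.range →ₗ[k] f.range := g.restrict hmaps
  have hr : r.index = 0 := by rw [index_eq_of_finiteDimensional, sub_self]
  have hker : finrank k r.ker = finrank k g.ker := by
    refine LinearEquiv.finrank_eq (LinearEquiv.ofBijective
      ((f.range.subtype ∘ₗ r.ker.subtype).codRestrict g.ker fun x => ?_) ⟨?_, ?_⟩)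
    · exact congrArg Subtype.val (LinearMap.mem_ker.1 x.2)
    · intro x y hxy
      have h : ((x : f.range) : M) = (y : f.range) :=
        congrArg (Subtype.val : g.ker → M) hxy
      exact Subtype.ext (Subtype.ext h)
    · rintro ⟨x, hx⟩
      have hx' : x + f x = 0 := hx
      refine ⟨⟨⟨x, ⟨-x, ?_⟩⟩, ?_⟩, rfl⟩
      · rw [map_neg, eq_comm, eq_neg_iff_add_eq_zero, hx']
      · exact LinearMap.mem_ker.2 (Subtype.ext hx')
  have hcoker : finrank k (f.range ⧸ r.range) = finrank k (M ⧸ g.range) := by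
    let φ : f.range →ₗ[k] M ⧸ g.range := g.range.mkQ ∘ₗ f.range.subtype
    have hφ : Function.Surjective φ := by
      intro y
      obtain ⟨x, rfl⟩ := g.range.mkQ_surjective y
      -- Modulo the range of `g`, `x` equals `f (-x)`, since `f (-x) - x = g (-x)`.
      refine ⟨⟨f (-x), ⟨-x, rfl⟩⟩, ?_⟩
      change g.range.mkQ (f (-x)) = g.range.mkQ x
      rw [← sub_eq_zero, ← map_sub, ← LinearMap.mem_ker, Submodule.ker_mkQ]
      exact ⟨-x, by rw [hgx]; abel⟩
    have hφk : φ.ker = r.range := by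
      ext ⟨y, hy⟩
      constructor
      · intro h
        have h' : y ∈ g.range := by
          rw [← Submodule.ker_mkQ g.range]; exact h
        obtain ⟨z, hz⟩ := h'
        have hzr : z ∈ f.range := by
          have : z = y - f z := by rw [← hz, hgx]; abel
          rw [this]
          exact f.range.sub_mem hy ⟨z, rfl⟩
        exact ⟨⟨z, hzr⟩, Subtype.ext hz⟩
      · rintro ⟨z, hz⟩
        have hz' : g z = y := congrArg Subtype.val hz
        change g.range.mkQ y = 0
        rw [← LinearMap.mem_ker, Submodule.ker_mkQ]
        exact ⟨z, hz'⟩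
    rw [← hφk]
    exact (φ.quotKerEquivOfSurjective hφ).finrank_eq
  rw [index_eq_finrank_sub] at hr ⊢
  rw [← hker, ← hcoker, hr]

end LinearMap

/-! ### Fredholm operators modulo finite rank; stability of the index. -/

namespace ContinuousLinearMap

variable {X : Type*} [NormedAddCommGroup X] [NormedSpace ℂ X]

open LinearMap.FiniteRangeSetoid in
/-- Quasi-inverses in terms of the ring structure on bounded operators. -/
theorem isQuasiInverse_iff {A V : X →L[ℂ] X} :
    (V : X →ₗ[ℂ] X).IsQuasiInverse (A : X →ₗ[ℂ] X) ↔
      ((V * A - 1 : X →L[ℂ] X) : X →ₗ[ℂ] X).HasFiniteRange ∧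
        ((A * V - 1 : X →L[ℂ] X) : X →ₗ[ℂ] X).HasFiniteRange := by
  rw [LinearMap.IsQuasiInverse, LinearMap.IsLeftQuasiInverse, LinearMap.IsRightQuasiInverse,
    equiv_iff_hasFiniteRange, equiv_iff_hasFiniteRange]
  rfl

variable (X) in
/-- The ideal of finite rank operators. -/
def finiteRankIdeal : Ideal (X →L[ℂ] X) where
  carrier := {f | (f : X →ₗ[ℂ] X).HasFiniteRange}
  add_mem' hf hg := LinearMap.HasFiniteRange.add hf hg
  zero_mem' := LinearMap.HasFiniteRange.zero
  smul_mem' c _ hf := LinearMap.HasFiniteRange.comp_left hf (c : X →ₗ[ℂ] X)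

theorem mem_finiteRankIdeal {f : X →L[ℂ] X} :
    f ∈ finiteRankIdeal X ↔ (f : X →ₗ[ℂ] X).HasFiniteRange := Iff.rfl

instance : (finiteRankIdeal X).IsTwoSided :=
  ⟨fun b hf => LinearMap.HasFiniteRange.comp_right hf (b : X →ₗ[ℂ] X)⟩

theorem isFredholm_iff_exists {A : X →L[ℂ] X} :
    A.IsFredholm ↔ ∃ V : X →L[ℂ] X, V * A - 1 ∈ finiteRankIdeal X ∧
      A * V - 1 ∈ finiteRankIdeal X := by
  rw [isFredholm_iff_exists_isQuasiInverse]
  exact exists_congr fun V => isQuasiInverse_iff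

/-- Atkinson's theorem modulo finite rank operators. -/
theorem isFredholm_iff_isUnit_mk {A : X →L[ℂ] X} :
    A.IsFredholm ↔ IsUnit (Ideal.Quotient.mk (finiteRankIdeal X) A) := by
  rw [isFredholm_iff_exists, isUnit_iff_exists]
  have key : ∀ B C : X →L[ℂ] X, B * C - 1 ∈ finiteRankIdeal X ↔
      Ideal.Quotient.mk (finiteRankIdeal X) B * Ideal.Quotient.mk (finiteRankIdeal X) C = 1 := by
    intro B C
    rw [← map_mul, ← map_one (Ideal.Quotient.mk (finiteRankIdeal X)), Ideal.Quotient.eq]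
  constructor
  · rintro ⟨V, h1, h2⟩
    exact ⟨_, (key _ _).1 h2, (key _ _).1 h1⟩
  · rintro ⟨v, h1, h2⟩
    obtain ⟨V, rfl⟩ := Ideal.Quotient.mk_surjective v
    exact ⟨V, (key _ _).2 h2, (key _ _).2 h1⟩

/-- A Fredholm operator of index zero. -/
def IsWeyl (A : X →L[ℂ] X) : Prop :=
  A.IsFredholm ∧ (A : X →ₗ[ℂ] X).index = 0

theorem IsFredholm.index_mul {A B : X →L[ℂ] X} (hA : A.IsFredholm) (hB : B.IsFredholm) :
    ((A * B : X →L[ℂ] X) : X →ₗ[ℂ] X).index =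
      (A : X →ₗ[ℂ] X).index + (B : X →ₗ[ℂ] X).index := by
  have := hA.finite_ker
  have := hB.finite_ker
  have := hA.finite_coker
  have := hB.finite_coker
  exact LinearMap.index_comp (f := (B : X →ₗ[ℂ] X)) (A : X →ₗ[ℂ] X)

theorem isFredholm_of_isUnit {A : X →L[ℂ] X} (hA : IsUnit A) : A.IsFredholm :=
  isFredholm_iff_isUnit_mk.2 (hA.map _)

theorem isFredholm_add_iff {A F : X →L[ℂ] X} (hF : F ∈ finiteRankIdeal X) :
    (A + F).IsFredholm ↔ A.IsFredholm := by
  rw [isFredholm_iff_isUnit_mk, isFredholm_iff_isUnit_mk, map_add,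
    Ideal.Quotient.eq_zero_iff_mem.2 hF, add_zero]

theorem isWeyl_of_isUnit {A : X →L[ℂ] X} (hA : IsUnit A) : A.IsWeyl := by
  refine ⟨isFredholm_of_isUnit hA, ?_⟩
  obtain ⟨u, rfl⟩ := hA
  exact (ContinuousLinearEquiv.ofUnit u).toLinearEquiv.index_eq_zero

/-- A finite rank perturbation of an invertible operator is Fredholm of index zero. -/
theorem isWeyl_add_of_isUnit {A F : X →L[ℂ] X} (hA : IsUnit A) (hF : F ∈ finiteRankIdeal X) :
    (A + F).IsWeyl := by
  refine ⟨(isFredholm_add_iff hF).2 (isFredholm_of_isUnit hA), ?_⟩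
  obtain ⟨u, rfl⟩ := hA
  have hG : (↑u⁻¹ * F : X →L[ℂ] X) ∈ finiteRankIdeal X := Ideal.mul_mem_left _ _ hF
  have h1 : (1 + ↑u⁻¹ * F : X →L[ℂ] X).IsFredholm :=
    (isFredholm_add_iff hG).2 (isFredholm_of_isUnit isUnit_one)
  have h2 : (u + F : X →L[ℂ] X) = u * (1 + ↑u⁻¹ * F) := by simp [mul_add]
  have h3 : ((1 + ↑u⁻¹ * F : X →L[ℂ] X) : X →ₗ[ℂ] X).index = 0 :=
    LinearMap.index_id_add_of_hasFiniteRange hG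
  rw [h2, (isFredholm_of_isUnit u.isUnit).index_mul h1, h3,
    (isWeyl_of_isUnit u.isUnit).2, add_zero]

/-- An operator is Fredholm as soon as its products with some operator, on both sides, are. -/
theorem isFredholm_of_mul {A V : X →L[ℂ] X} (h1 : (A * V).IsFredholm) (h2 : (V * A).IsFredholm) :
    A.IsFredholm := by
  rw [isFredholm_iff_isUnit_mk, map_mul] at h1 h2
  rw [isFredholm_iff_isUnit_mk, isUnit_iff_exists_and_exists]
  obtain ⟨b, hb, -⟩ := isUnit_iff_exists.1 h1
  obtain ⟨c, -, hc⟩ := isUnit_iff_exists.1 h2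
  exact ⟨⟨_, by rw [← mul_assoc]; exact hb⟩, ⟨_, by rw [mul_assoc]; exact hc⟩⟩

variable [CompleteSpace X]

/-- The Fredholm property and the index are stable under small perturbations. -/
theorem IsFredholm.eventually {A : X →L[ℂ] X} (hA : A.IsFredholm) :
    ∀ᶠ C : X →L[ℂ] X in 𝓝 A, C.IsFredholm ∧
      (C : X →ₗ[ℂ] X).index = (A : X →ₗ[ℂ] X).index := by
  obtain ⟨V, hVA, hAV⟩ := isFredholm_iff_exists.1 hA
  have e1 : ∀ᶠ C : X →L[ℂ] X in 𝓝 A, IsUnit (1 + (C - A) * V) := by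
    have hc : Continuous fun C : X →L[ℂ] X => 1 + (C - A) * V := by fun_prop
    exact hc.continuousAt.eventually (Units.isOpen.mem_nhds (by simp))
  have e2 : ∀ᶠ C : X →L[ℂ] X in 𝓝 A, IsUnit (1 + V * (C - A)) := by
    have hc : Continuous fun C : X →L[ℂ] X => 1 + V * (C - A) := by fun_prop
    exact hc.continuousAt.eventually (Units.isOpen.mem_nhds (by simp))
  -- `C * V` and `V * C` are each a unit plus a finite rank operator. Hence `ind C = -ind V` for
  -- every such `C`, including `C = A`.
  have key : ∀ C : X →L[ℂ] X, IsUnit (1 + (C - A) * V) → IsUnit (1 + V * (C - A)) →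
      C.IsFredholm ∧ V.IsFredholm ∧ (C * V).IsWeyl := by
    intro C h1 h2
    have w1 : (C * V).IsWeyl := by
      have := isWeyl_add_of_isUnit h1 hAV
      rwa [show 1 + (C - A) * V + (A * V - 1) = C * V by noncomm_ring] at this
    have w2 : (V * C).IsWeyl := by
      have := isWeyl_add_of_isUnit h2 hVA
      rwa [show 1 + V * (C - A) + (V * A - 1) = V * C by noncomm_ring] at this
    exact ⟨isFredholm_of_mul w1.1 w2.1, isFredholm_of_mul w2.1 w1.1, w1⟩
  obtain ⟨-, hV, hAVw⟩ := key A (by simp) (by simp)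
  filter_upwards [e1, e2] with C h1 h2
  obtain ⟨hC, -, hCV⟩ := key C h1 h2
  refine ⟨hC, ?_⟩
  have i1 := hA.index_mul hV
  have i2 := hC.index_mul hV
  rw [hAVw.2] at i1
  rw [hCV.2] at i2
  linarith

theorem isOpen_setOf_isWeyl : IsOpen {A : X →L[ℂ] X | A.IsWeyl} := by
  rw [isOpen_iff_mem_nhds]
  intro A hA
  filter_upwards [hA.1.eventually] with C hC
  exact ⟨hC.1, hC.2.trans hA.2⟩

/-- The index is constant along paths of Fredholm operators. -/
theorem IsWeyl.of_path {γ : ℝ → X →L[ℂ] X} (hγ : Continuous γ)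
    (hF : ∀ t ∈ Set.Icc (0 : ℝ) 1, (γ t).IsFredholm) (h0 : (γ 0).IsWeyl) : (γ 1).IsWeyl := by
  have hc : ContinuousOn (fun t => ((γ t : X →L[ℂ] X) : X →ₗ[ℂ] X).index) (Set.Icc (0 : ℝ) 1) := by
    intro t ht
    refine ContinuousAt.continuousWithinAt ?_
    exact continuousAt_const.congr
      (hγ.continuousAt.eventually ((hF t ht).eventually.mono fun C hC => hC.2.symm))
  refine ⟨hF 1 (by simp), ?_⟩
  rw [isPreconnected_Icc.constant hc (x := 1) (y := 0) (by simp) (by simp)]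
  exact h0.2

end ContinuousLinearMap

/-! ### Perturbation of the spectrum in Banach algebras. -/

section BanachAlgebra

theorem isUnit_add_of_norm_mul_lt_one {Q : Type*} [NormedRing Q] [CompleteSpace Q]
    {s c d : Q} (hsc : s * c = 1) (hcs : c * s = 1)
    (h : ‖c * d‖ < 1) : IsUnit (s + d) := by
  have h1 : IsUnit (1 - -(c * d)) := isUnit_one_sub_of_norm_lt_one (by rwa [norm_neg])
  have h2 : s + d = s * (1 - -(c * d)) := by
    rw [sub_neg_eq_add, mul_add, ← mul_assoc, hsc]; simp
  rw [h2]
  exact (isUnit_iff_exists.2 ⟨c, hsc, hcs⟩).mul h1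

variable {Q : Type*} [NormedRing Q] [NormedAlgebra ℂ Q]

open ENNReal NNReal in
/-- If a disc about the origin consists of regular points of `s`, the spectral radius of the
inverse of `s` is at most the inverse of the radius. -/
theorem spectralRadius_inverse_le {s c : Q} (hsc : s * c = 1) (hcs : c * s = 1) {ε : ℝ≥0}
    (h : ∀ z : ℂ, ‖z‖ < ε → IsUnit (s - algebraMap ℂ Q z)) :
    spectralRadius ℂ c * ε ≤ 1 := by
  let u : Qˣ := ⟨c, s, hcs, hsc⟩
  rw [← ENNReal.le_div_iff_mul_le (Or.inr one_ne_zero) (Or.inl coe_ne_top), one_div]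
  refine iSup₂_le fun z hz => ?_
  rcases eq_or_ne z 0 with rfl | hz0
  · simp
  have hz1 : z⁻¹ ∈ spectrum ℂ s := by
    have := (spectrum.inv_mem_iff (r := Units.mk0 z hz0) (a := u)).1 hz
    simpa [u] using this
  have hz2 : ¬ ‖z⁻¹‖ < ε := by
    intro hlt
    refine hz1 ?_
    have := (h _ hlt).neg
    rwa [neg_sub] at this
  rw [norm_inv, not_lt] at hz2
  rw [ENNReal.le_inv_iff_mul_le, mul_comm]
  have : ε * ‖z‖₊ ≤ 1 := by
    rw [← NNReal.coe_le_coe]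
    have hp : 0 < ‖z‖ := norm_pos_iff.2 hz0
    calc (ε : ℝ) * ‖z‖ ≤ ‖z‖⁻¹ * ‖z‖ := by gcongr
      _ = 1 := inv_mul_cancel₀ hp.ne'
  exact_mod_cast this

variable [CompleteSpace Q]

open ENNReal NNReal in
/-- The spectral radius is submultiplicative, against the norm, on commuting elements. -/
theorem Commute.spectralRadius_mul_le {c d : Q} (h : Commute c d) :
    spectralRadius ℂ (c * d) ≤ spectralRadius ℂ c * ‖d‖₊ := by
  have h1 := spectrum.pow_nnnorm_pow_one_div_tendsto_nhds_spectralRadius (c * d)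
  have h2 := ENNReal.Tendsto.mul_const
    (spectrum.pow_nnnorm_pow_one_div_tendsto_nhds_spectralRadius c) (b := (‖d‖₊ : ℝ≥0∞))
    (Or.inr coe_ne_top)
  refine le_of_tendsto_of_tendsto h1 h2 ?_
  filter_upwards [eventually_gt_atTop 0] with n hn
  have hn' : (n : ℝ) ≠ 0 := by positivity
  calc (‖(c * d) ^ n‖₊ : ℝ≥0∞) ^ (1 / n : ℝ)
      ≤ ((‖c ^ n‖₊ : ℝ≥0∞) * (‖d‖₊ : ℝ≥0∞) ^ n) ^ (1 / n : ℝ) := by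
        gcongr
        rw [h.mul_pow]
        exact_mod_cast (nnnorm_mul_le _ _).trans
          (mul_le_mul_right (nnnorm_pow_le' d hn) _)
    _ = (‖c ^ n‖₊ : ℝ≥0∞) ^ (1 / n : ℝ) * ‖d‖₊ := by
        rw [ENNReal.mul_rpow_of_nonneg _ _ (by positivity), ← ENNReal.rpow_natCast,
          ← ENNReal.rpow_mul, mul_one_div_cancel hn', ENNReal.rpow_one]

open ENNReal NNReal in
/-- Commuting perturbations of size less than the distance to the spectrum keep invertibility. -/
theorem Commute.isUnit_add {s d : Q} (hsd : Commute s d) {ε : ℝ}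
    (hd : ‖d‖ < ε) (h : ∀ z : ℂ, ‖z‖ < ε → IsUnit (s - algebraMap ℂ Q z)) : IsUnit (s + d) := by
  have hε : 0 < ε := (norm_nonneg d).trans_lt hd
  lift ε to ℝ≥0 using hε.le
  have h0 : IsUnit s := by simpa using h 0 (by simpa using hε)
  obtain ⟨c, hsc, hcs⟩ := isUnit_iff_exists.1 h0
  have hcd : Commute c d := by
    change c * d = d * c
    calc c * d = c * d * (s * c) := by rw [hsc, mul_one]
      _ = c * (d * s) * c := by noncomm_ring
      _ = c * (s * d) * c := by rw [hsd.eq]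
      _ = (c * s) * (d * c) := by noncomm_ring
      _ = d * c := by rw [hcs, one_mul]
  -- As `s + d = s * (1 + c * d)`, it suffices that `-1` lies outside the spectrum of `c * d`;
  -- commutation lets the spectral radius of `c`, at most `1 / ε`, replace its norm.
  have hr : spectralRadius ℂ (c * d) < 1 := by
    rcases eq_or_ne d 0 with rfl | hd0
    · simp
    refine hcd.spectralRadius_mul_le.trans_lt ?_
    have h1 := spectralRadius_inverse_le hsc hcs h
    have hε0 : (ε : ℝ≥0∞) ≠ 0 := by exact_mod_cast hε.ne'
    have hr' : spectralRadius ℂ c ≤ (ε : ℝ≥0∞)⁻¹ := by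
      rw [ENNReal.le_inv_iff_mul_le]; exact h1
    have hd' : (‖d‖₊ : ℝ≥0∞) < ε := by exact_mod_cast hd
    calc spectralRadius ℂ c * ‖d‖₊ ≤ (ε : ℝ≥0∞)⁻¹ * ‖d‖₊ := by gcongr
      _ < (ε : ℝ≥0∞)⁻¹ * ε :=
        (ENNReal.mul_lt_mul_iff_right (ENNReal.inv_ne_zero.2 coe_ne_top)
          (ENNReal.inv_ne_top.2 hε0)).2 hd'
      _ = 1 := ENNReal.inv_mul_cancel hε0 coe_ne_top
  have h1 : IsUnit (1 + c * d) := by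
    have hm : (-1 : ℂ) ∈ resolventSet ℂ (c * d) :=
      spectrum.mem_resolventSet_of_spectralRadius_lt (by simpa using hr)
    have := (spectrum.mem_resolventSet_iff.1 hm).neg
    simpa [add_comm] using this
  have h2 : s + d = s * (1 + c * d) := by rw [mul_add, ← mul_assoc, hsc]; simp
  rw [h2]
  exact h0.mul h1

/-- Around a point of a totally disconnected compact plane set there are arbitrarily small open
sets whose boundary misses the set. -/
theorem exists_isOpen_frontier_disjoint {S : Set ℂ} (hS : IsCompact S)
    (hd : IsTotallyDisconnected S) {y : ℂ} (hy : y ∈ S) {ε : ℝ} (hε : 0 < ε) :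
    ∃ U : Set ℂ, IsOpen U ∧ y ∈ U ∧ closure U ⊆ Metric.ball y ε ∧ Disjoint (frontier U) S := by
  have : CompactSpace S := isCompact_iff_compactSpace.1 hS
  have : TotallyDisconnectedSpace S := totallyDisconnectedSpace_subtype_iff.2 hd
  obtain ⟨V, hV, hyV, hVb⟩ := compact_exists_isClopen_in_isOpen
    (Metric.isOpen_ball.preimage continuous_subtype_val : IsOpen (Subtype.val ⁻¹' Metric.ball y ε))
    (x := (⟨y, hy⟩ : S)) (Metric.mem_ball_self hε)
  set K : Set ℂ := Subtype.val '' V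
  set K' : Set ℂ := Subtype.val '' Vᶜ
  have hK : IsCompact K := hV.1.isCompact.image continuous_subtype_val
  have hK' : IsCompact K' := hV.2.isClosed_compl.isCompact.image continuous_subtype_val
  -- A thin thickening of `K` stays in the ball and away from `K'`. Its boundary misses `K`, which
  -- lies in its interior, and `K'`, hence all of `S`.
  have hdisj : Disjoint K (K' ∪ (Metric.ball y ε)ᶜ) := by
    rw [Set.disjoint_union_right]
    refine ⟨(Set.disjoint_image_iff Subtype.val_injective).2 disjoint_compl_right, ?_⟩
    rw [Set.disjoint_compl_right_iff_subset]
    exact Set.image_subset_iff.2 hVb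
  obtain ⟨δ, hδ, hδd⟩ := hdisj.exists_cthickenings hK
    (hK'.isClosed.union Metric.isOpen_ball.isClosed_compl)
  have hδd' : Disjoint (Metric.cthickening δ K) (K' ∪ (Metric.ball y ε)ᶜ) :=
    hδd.mono_right (Metric.self_subset_cthickening _)
  rw [Set.disjoint_union_right, Set.disjoint_compl_right_iff_subset] at hδd'
  have hcl : closure (Metric.thickening δ K) ⊆ Metric.cthickening δ K :=
    Metric.closure_thickening_subset_cthickening δ K
  refine ⟨Metric.thickening δ K, Metric.isOpen_thickening,
    Metric.self_subset_thickening hδ K ⟨_, hyV, rfl⟩, hcl.trans hδd'.2, ?_⟩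
  rw [Set.disjoint_left]
  intro z hz hzS
  by_cases hzV : (⟨z, hzS⟩ : S) ∈ V
  · rw [Metric.isOpen_thickening.frontier_eq] at hz
    exact hz.2 (Metric.self_subset_thickening hδ K ⟨_, hzV, rfl⟩)
  · exact Set.disjoint_left.1 hδd'.1 (hcl (frontier_subset_closure hz)) ⟨_, hzV, rfl⟩

/-- Lower semicontinuity of the spectrum at elements with totally disconnected spectrum. -/
theorem isUnit_of_isTotallyDisconnected_spectrum {a : Q}
    (ha : IsTotallyDisconnected (spectrum ℂ a)) {b : ℕ → Q} (hb : Tendsto b atTop (𝓝 a))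
    {y : ℂ} {ε : ℝ} (hε : 0 < ε)
    (h : ∃ᶠ n in atTop, ∀ z ∈ Metric.ball y ε, IsUnit (algebraMap ℂ Q z - b n)) :
    IsUnit (algebraMap ℂ Q y - a) := by
  by_contra hy
  obtain ⟨U, hU, hyU, hUb, hUd⟩ := exists_isOpen_frontier_disjoint (spectrum.isCompact a) ha hy hε
  have hUbdd : Bornology.IsBounded U :=
    Metric.isBounded_ball.subset (subset_closure.trans hUb)
  have hfc : IsCompact (frontier U) :=
    Metric.isCompact_of_isClosed_isBounded isClosed_frontier
      (hUbdd.closure.subset frontier_subset_closure)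
  have hunit : ∀ z ∈ frontier U, IsUnit (algebraMap ℂ Q z - a) := fun z hz =>
    not_not.1 (Set.disjoint_left.1 hUd hz)
  have hcont : ∀ z ∈ frontier U,
      ContinuousAt (fun p : Q × ℂ => Ring.inverse (algebraMap ℂ Q p.2 - p.1)) (a, z) := by
    intro z hz
    obtain ⟨u, hu⟩ := hunit z hz
    have h1 : ContinuousAt Ring.inverse (algebraMap ℂ Q z - a) := by
      rw [← hu]; exact NormedRing.inverse_continuousAt u
    have h2 : ContinuousAt (fun p : Q × ℂ => algebraMap ℂ Q p.2 - p.1) (a, z) := by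
      have := continuous_algebraMap ℂ Q
      fun_prop
    exact ContinuousAt.comp (f := fun p : Q × ℂ => algebraMap ℂ Q p.2 - p.1) h1 h2
  obtain ⟨M, hM⟩ := hfc.exists_bound_of_continuousOn
    (f := fun z => Ring.inverse (algebraMap ℂ Q z - a)) fun z hz =>
      ((hcont z hz).comp (f := fun w : ℂ => (a, w)) (by fun_prop)).continuousWithinAt
  -- The resolvent is jointly continuous, so its bound on the compact boundary persists for nearby
  -- elements; `max M 0 + 1` makes the bound strict and positive.
  have hev : ∀ᶠ b' in 𝓝 a, ∀ z ∈ frontier U,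
      ‖Ring.inverse (algebraMap ℂ Q z - b')‖ < max M 0 + 1 := by
    refine hfc.eventually_forall_of_forall_eventually fun z hz => ?_
    refine (hcont z hz).norm.eventually (Iio_mem_nhds ?_)
    exact ((hM z hz).trans (le_max_left _ _)).trans_lt (lt_add_one _)
  set N := max M 0 + 1
  have hN : 0 < N := by positivity
  have hev2 : ∀ᶠ n in atTop, ‖b n - a‖ < 1 / N := by
    have := hb.eventually (Metric.ball_mem_nhds a (show 0 < 1 / N by positivity))
    simpa [dist_eq_norm] using this
  obtain ⟨n, hn, hn1, hn2⟩ := (h.and_eventually ((hb.eventually hev).and hev2)).exists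
  have hdiff : DiffContOnCl ℂ (fun z => Ring.inverse (algebraMap ℂ Q z - b n)) U := by
    refine DifferentiableOn.diffContOnCl fun z hz => ?_
    have := (spectrum.hasDerivAt_resolvent_const_left (𝕜 := ℂ) (a := b n) (k := z)
      (hn z (hUb hz))).differentiableAt
    exact this.differentiableWithinAt
  -- By the maximum principle the resolvent of `b n` at `y` has norm at most `N`, so the
  -- perturbation `b n - a`, of norm below `1 / N`, preserves invertibility.
  have hmax := Complex.norm_le_of_forall_mem_frontier_norm_le hUbdd hdiff
    (fun z hz => (hn1 z hz).le) (subset_closure hyU)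
  have hsu := hn y (Metric.mem_ball_self hε)
  refine hy ?_
  have := isUnit_add_of_norm_mul_lt_one (Ring.mul_inverse_cancel _ hsu)
    (Ring.inverse_mul_cancel _ hsu) (d := b n - a) ?_
  · simpa using this
  · calc _ ≤ N * ‖b n - a‖ := (norm_mul_le _ _).trans (by gcongr)
      _ < N * (1 / N) := by gcongr
      _ = 1 := mul_one_div_cancel hN.ne'

/-- The complement of a totally disconnected plane set is dense. -/
theorem IsTotallyDisconnected.dense_compl {S : Set ℂ} (hS : IsTotallyDisconnected S) :
    Dense Sᶜ := by
  rw [← interior_eq_empty_iff_dense_compl, Set.eq_empty_iff_forall_notMem]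
  intro z hz
  obtain ⟨ε, hε, hb⟩ := Metric.isOpen_iff.1 isOpen_interior z hz
  have hsub : (Metric.ball z ε).Subsingleton :=
    hS _ (hb.trans interior_subset) (convex_ball z ε).isPreconnected
  have h1 : z + (ε / 2 : ℝ) ∈ Metric.ball z ε := by
    rw [Metric.mem_ball, dist_eq_norm, add_sub_cancel_left, Complex.norm_real, Real.norm_eq_abs,
      abs_of_pos (by positivity)]
    linarith
  have h2 := hsub h1 (Metric.mem_ball_self hε)
  rw [add_eq_left, Complex.ofReal_eq_zero] at h2
  linarith

end BanachAlgebra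

/-! ### The quotient by approximable operators and Atkinson's theorem. -/

namespace ContinuousLinearMap

section Calkin

variable {X : Type*} [NormedAddCommGroup X] [NormedSpace ℂ X]

variable (X) in
/-- The closed ideal generated by the finite rank operators. -/
noncomputable def approximableIdeal : Ideal (X →L[ℂ] X) := (finiteRankIdeal X).closure

theorem mem_approximableIdeal {A : X →L[ℂ] X} :
    A ∈ approximableIdeal X ↔ A ∈ closure (finiteRankIdeal X : Set (X →L[ℂ] X)) := Iff.rfl

theorem finiteRankIdeal_le_approximableIdeal : finiteRankIdeal X ≤ approximableIdeal X :=
  fun _ h => subset_closure h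

instance : (approximableIdeal X).IsTwoSided where
  mul_mem_of_left {a} b ha := by
    have hc : Continuous fun c : X →L[ℂ] X => c * b := by fun_prop
    exact map_mem_closure (f := fun c : X →L[ℂ] X => c * b) hc ha
      fun c hc => Ideal.mul_mem_right b _ hc

instance isClosed_approximableIdeal : IsClosed (approximableIdeal X : Set (X →L[ℂ] X)) :=
  isClosed_closure

variable (X) in
/-- Bounded operators modulo the closure of the finite rank operators. -/
abbrev FredholmAlgebra : Type _ := (X →L[ℂ] X) ⧸ approximableIdeal X

noncomputable instance : NormedRing (FredholmAlgebra X) where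
  __ := Submodule.Quotient.normedAddCommGroup (approximableIdeal X)
  __ := Ideal.Quotient.ring (approximableIdeal X)
  norm_mul_le a b := by
    refine le_of_forall_pos_lt_add fun ε hε => ?_
    have hlim : Tendsto (fun t : ℝ => (‖a‖ + t) * (‖b‖ + t)) (𝓝[>] 0) (𝓝 (‖a‖ * ‖b‖)) := by
      have : Continuous fun t : ℝ => (‖a‖ + t) * (‖b‖ + t) := by fun_prop
      simpa using (this.tendsto 0).mono_left nhdsWithin_le_nhds
    obtain ⟨t, ht, ht0⟩ := ((hlim.eventually (Iio_mem_nhds (lt_add_of_pos_right _ hε))).and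
      self_mem_nhdsWithin).exists
    obtain ⟨A, rfl, hA⟩ := Submodule.Quotient.norm_mk_lt a ht0
    obtain ⟨B, rfl, hB⟩ := Submodule.Quotient.norm_mk_lt b ht0
    calc _ ≤ ‖A * B‖ := Submodule.Quotient.norm_mk_le (approximableIdeal X) (A * B)
      _ ≤ ‖A‖ * ‖B‖ := norm_mul_le _ _
      _ ≤ _ := by gcongr
      _ < _ := ht

noncomputable instance : NormedAlgebra ℂ (FredholmAlgebra X) where
  norm_smul_le := norm_smul_le

variable (X) in
/-- The quotient map to `FredholmAlgebra X`. -/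
noncomputable def toFredholmAlgebra : (X →L[ℂ] X) →ₐ[ℂ] FredholmAlgebra X :=
  Ideal.Quotient.mkₐ ℂ (approximableIdeal X)

theorem toFredholmAlgebra_surjective : Function.Surjective (toFredholmAlgebra X) :=
  Ideal.Quotient.mkₐ_surjective ℂ _

theorem norm_toFredholmAlgebra_le (A : X →L[ℂ] X) : ‖toFredholmAlgebra X A‖ ≤ ‖A‖ :=
  Submodule.Quotient.norm_mk_le (approximableIdeal X) A

theorem continuous_toFredholmAlgebra : Continuous (toFredholmAlgebra X) :=
  AddMonoidHomClass.continuous_of_bound (toFredholmAlgebra X) 1 fun A => by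
    simpa using norm_toFredholmAlgebra_le A

theorem toFredholmAlgebra_eq_iff {A B : X →L[ℂ] X} :
    toFredholmAlgebra X A = toFredholmAlgebra X B ↔ A - B ∈ approximableIdeal X :=
  Ideal.Quotient.eq

variable [CompleteSpace X]

/-- A perturbation of the identity by an approximable operator is Fredholm. -/
theorem isFredholm_of_sub_one_mem {A : X →L[ℂ] X} (hA : A - 1 ∈ approximableIdeal X) :
    A.IsFredholm := by
  obtain ⟨F, hF, hd⟩ := Metric.mem_closure_iff.1 (mem_approximableIdeal.1 hA) 1 one_pos
  rw [dist_eq_norm] at hd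
  -- Replacing `A - 1` by a finite rank operator within distance one writes `A` as a unit plus
  -- finite rank.
  have hu : IsUnit (1 - (F - (A - 1))) :=
    isUnit_one_sub_of_norm_lt_one (by rwa [norm_sub_rev])
  have := (isWeyl_add_of_isUnit hu hF).1
  rwa [show 1 - (F - (A - 1)) + F = A by abel] at this

/-- Atkinson's theorem. -/
theorem isFredholm_iff_isUnit {A : X →L[ℂ] X} :
    A.IsFredholm ↔ IsUnit (toFredholmAlgebra X A) := by
  constructor
  · intro h
    obtain ⟨V, h1, h2⟩ := isFredholm_iff_exists.1 h
    refine isUnit_iff_exists.2 ⟨toFredholmAlgebra X V, ?_, ?_⟩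
    · rw [← map_mul, ← map_one (toFredholmAlgebra X), toFredholmAlgebra_eq_iff]
      exact finiteRankIdeal_le_approximableIdeal h2
    · rw [← map_mul, ← map_one (toFredholmAlgebra X), toFredholmAlgebra_eq_iff]
      exact finiteRankIdeal_le_approximableIdeal h1
  · intro h
    obtain ⟨v, h1, h2⟩ := isUnit_iff_exists.1 h
    obtain ⟨V, rfl⟩ := toFredholmAlgebra_surjective v
    rw [← map_mul, ← map_one (toFredholmAlgebra X), toFredholmAlgebra_eq_iff] at h1 h2
    exact isFredholm_of_mul (isFredholm_of_sub_one_mem h1) (isFredholm_of_sub_one_mem h2)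

end Calkin

/-! ### Normal operators on a Hilbert space. -/

section Hilbert

variable {H : Type*} [NormedAddCommGroup H] [InnerProductSpace ℂ H] [CompleteSpace H]

open Submodule in
-- Let `P` project onto `ker F`. Then `A * P` has the class of `A`, and compressing `star A * A + F`
-- by `P` removes `F` and leaves `star (A * P) * (A * P)`, to which the C⋆-identity applies.
theorem norm_toFredholmAlgebra_sq_le_norm_add (A : H →L[ℂ] H) {F : H →L[ℂ] H}
    (hF : F ∈ finiteRankIdeal H) : ‖toFredholmAlgebra H A‖ ^ 2 ≤ ‖star A * A + F‖ := by
  have hcl : IsClosed (F.ker : Set H) := F.isClosed_ker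
  have : CompleteSpace F.ker := hcl.completeSpace_coe
  set P : H →L[ℂ] H := F.ker.starProjection
  have hPs : star P = P := isSelfAdjoint_starProjection _
  have hP1 : ‖P‖ ≤ 1 := starProjection_norm_le _
  have hFP : F * P = 0 := by
    ext x
    exact F.ker.starProjection_apply_mem x
  have hPfin : A * P - A ∈ finiteRankIdeal H := by
    have : (1 - P) ∈ finiteRankIdeal H := by
      rw [mem_finiteRankIdeal, ← LinearMap.ker_coFG_iff_hasFiniteRange]
      refine (LinearMap.ker_coFG_iff_hasFiniteRange.2 hF).of_le fun x hx => ?_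
      have hx' : P x = x := starProjection_eq_self_iff.2 hx
      exact LinearMap.mem_ker.2 (by simp [hx'])
    have h2 := (finiteRankIdeal H).neg_mem (Ideal.mul_mem_left _ A this)
    rwa [mul_sub, mul_one, neg_sub] at h2
  have h1 : toFredholmAlgebra H A = toFredholmAlgebra H (A * P) :=
    (toFredholmAlgebra_eq_iff.2 (finiteRankIdeal_le_approximableIdeal hPfin)).symm
  have h2 : star (A * P) * (A * P) = P * (star A * A + F) * P := by
    have : P * (star A * A + F) * P = P * (star A * A) * P + P * (F * P) := by noncomm_ring
    rw [this, hFP, star_mul, hPs]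
    noncomm_ring
  calc ‖toFredholmAlgebra H A‖ ^ 2 ≤ ‖A * P‖ ^ 2 := by
        rw [h1]; gcongr; exact norm_toFredholmAlgebra_le _
    _ = ‖P * (star A * A + F) * P‖ := by rw [← h2, CStarRing.norm_star_mul_self, sq]
    _ ≤ ‖P‖ * ‖star A * A + F‖ * ‖P‖ :=
        (norm_mul_le _ _).trans (by gcongr; exact norm_mul_le _ _)
    _ ≤ 1 * ‖star A * A + F‖ * 1 := by gcongr
    _ = _ := by ring

/-- The C⋆-inequality in the quotient by the approximable operators. -/
theorem norm_toFredholmAlgebra_sq_le (A : H →L[ℂ] H) :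
    ‖toFredholmAlgebra H A‖ ^ 2 ≤ ‖toFredholmAlgebra H (star A * A)‖ := by
  refine le_of_forall_pos_le_add fun ε hε => ?_
  obtain ⟨B, hB, hBn⟩ := Submodule.Quotient.norm_mk_lt
    (S := approximableIdeal H) (toFredholmAlgebra H (star A * A)) (half_pos hε)
  have hm : B - star A * A ∈ approximableIdeal H := toFredholmAlgebra_eq_iff.1 hB
  obtain ⟨F, hF, hd⟩ := Metric.mem_closure_iff.1 (mem_approximableIdeal.1 hm) _ (half_pos hε)
  rw [dist_eq_norm, norm_sub_rev] at hd
  calc _ ≤ ‖star A * A + F‖ := norm_toFredholmAlgebra_sq_le_norm_add A hF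
    _ = ‖B + (F - (B - star A * A))‖ := by congr 1; abel
    _ ≤ ‖B‖ + ‖F - (B - star A * A)‖ := norm_add_le _ _
    _ ≤ ‖toFredholmAlgebra H (star A * A)‖ + ε := by linarith

/-- Divide the C⋆-inequality by the norm of the class of `A`. Adjoints are taken on representatives,
so no involution on the quotient is needed. -/
theorem norm_toFredholmAlgebra_le_star (A : H →L[ℂ] H) :
    ‖toFredholmAlgebra H A‖ ≤ ‖toFredholmAlgebra H (star A)‖ := by
  rcases (norm_nonneg (toFredholmAlgebra H A)).eq_or_lt with h | h
  · rw [← h]; positivity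
  have h1 := norm_toFredholmAlgebra_sq_le A
  rw [map_mul] at h1
  have h2 := h1.trans (norm_mul_le _ _)
  rw [sq] at h2
  exact le_of_mul_le_mul_right h2 h

/-- Normality turns the square of `star B * B` into `star (B ^ 2) * B ^ 2`; the C⋆-inequality is
used for `B` and for `star B * B`. -/
theorem norm_toFredholmAlgebra_sq_le_of_isStarNormal {B : H →L[ℂ] H} (hB : IsStarNormal B) :
    ‖toFredholmAlgebra H B‖ ^ 2 ≤ ‖toFredholmAlgebra H (B ^ 2)‖ := by
  have h1 := norm_toFredholmAlgebra_sq_le B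
  have h2 := norm_toFredholmAlgebra_sq_le (star B * B)
  have h3 : star (star B * B) * (star B * B) = star (B ^ 2) * B ^ 2 := by
    have h := hB.star_comm_self.eq
    rw [star_mul, star_star, star_pow, sq, sq, mul_assoc, ← mul_assoc B, ← h]
    simp only [mul_assoc]
  have h4 : ‖toFredholmAlgebra H (star (B ^ 2))‖ ≤ ‖toFredholmAlgebra H (B ^ 2)‖ := by
    have h := norm_toFredholmAlgebra_le_star (star (B ^ 2))
    rwa [star_star] at h
  have h5 : ‖toFredholmAlgebra H (star (B ^ 2) * B ^ 2)‖ ≤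
      ‖toFredholmAlgebra H (star (B ^ 2))‖ * ‖toFredholmAlgebra H (B ^ 2)‖ := by
    rw [map_mul]
    exact norm_mul_le _ _
  rw [h3] at h2
  generalize ‖toFredholmAlgebra H (B ^ 2)‖ = r at *
  generalize ‖toFredholmAlgebra H B‖ = p at *
  have hr : 0 ≤ r := (norm_nonneg _).trans h4
  refine le_of_sq_le_sq ?_ hr
  calc (p ^ 2) ^ 2 ≤ _ := pow_le_pow_left₀ (sq_nonneg _) h1 2
    _ ≤ _ := h2.trans h5
    _ ≤ r * r := mul_le_mul_of_nonneg_right h4 hr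
    _ = r ^ 2 := (sq r).symm

open ENNReal NNReal in
/-- The norm of the class of a normal operator is at most its spectral radius. -/
theorem nnnorm_le_spectralRadius_of_isStarNormal {B : H →L[ℂ] H} (hB : IsStarNormal B) :
    (‖toFredholmAlgebra H B‖₊ : ℝ≥0∞) ≤ spectralRadius ℂ (toFredholmAlgebra H B) := by
  have hpow : ∀ k : ℕ, ‖toFredholmAlgebra H B‖ ^ 2 ^ k ≤ ‖toFredholmAlgebra H B ^ 2 ^ k‖ := by
    intro k
    induction k with
    | zero => simp
    | succ k ih =>
      have hn : IsStarNormal (B ^ 2 ^ k) :=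
        ⟨by rw [star_pow]; exact hB.star_comm_self.pow_pow _ _⟩
      have := norm_toFredholmAlgebra_sq_le_of_isStarNormal hn
      rw [map_pow _ (B ^ 2 ^ k), map_pow, ← pow_mul, ← pow_succ] at this
      rw [pow_succ, pow_mul]
      exact (pow_le_pow_left₀ (by positivity) ih 2).trans this
  -- Gelfand's formula is needed only along the exponents `2 ^ k`, those reached by repeated
  -- squaring.
  have h1 := (spectrum.pow_nnnorm_pow_one_div_tendsto_nhds_spectralRadius
    (toFredholmAlgebra H B)).comp (tendsto_pow_atTop_atTop_of_one_lt (one_lt_two (α := ℕ)))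
  refine ge_of_tendsto' h1 fun k => ?_
  have hk : ((2 ^ k : ℕ) : ℝ) ≠ 0 := by positivity
  calc (‖toFredholmAlgebra H B‖₊ : ℝ≥0∞)
      = ((‖toFredholmAlgebra H B‖₊ : ℝ≥0∞) ^ (2 ^ k)) ^ (1 / ((2 ^ k : ℕ) : ℝ)) := by
        rw [← ENNReal.rpow_natCast, ← ENNReal.rpow_mul, mul_one_div_cancel hk, ENNReal.rpow_one]
    _ ≤ (‖toFredholmAlgebra H B ^ 2 ^ k‖₊ : ℝ≥0∞) ^ (1 / ((2 ^ k : ℕ) : ℝ)) := by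
        gcongr
        have := hpow k
        exact_mod_cast this

open Submodule in
/-- A normal Fredholm operator is a finite rank perturbation of a normal invertible operator. -/
theorem IsFredholm.exists_isUnit_of_isStarNormal {S : H →L[ℂ] H} (hF : S.IsFredholm)
    (hS : IsStarNormal S) : ∃ U : H →L[ℂ] H, IsUnit U ∧ IsStarNormal U ∧
      S - U ∈ finiteRankIdeal H := by
  have : FiniteDimensional ℂ S.ker := hF.finite_ker
  have : CompleteSpace S.range := hF.isClosed_range.completeSpace_coe
  have horth : S.rangeᗮ = S.ker := ContinuousLinearMap.IsStarNormal.orthogonal_range hS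
  have hrange : S.kerᗮ = S.range := by rw [← horth, orthogonal_orthogonal]
  set P : H →L[ℂ] H := S.ker.starProjection
  have hPs : star P = P := isSelfAdjoint_starProjection _
  have hSP : S * P = 0 := by
    ext x
    exact S.ker.starProjection_apply_mem x
  have hPS : P * S = 0 := by
    ext x
    refine (starProjection_apply_eq_zero_iff _).2 ?_
    rw [hrange]
    exact ⟨x, rfl⟩
  have hP : ∀ x, P x ∈ S.ker := S.ker.starProjection_apply_mem
  have hPk : ∀ x ∈ S.ker, P x = x := fun x hx => starProjection_eq_self_iff.2 hx
  have hPSx : ∀ x, P (S x) = 0 := fun x => congrArg (fun T : H →L[ℂ] H => T x) hPS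
  have hSPx : ∀ x, S (P x) = 0 := fun x => congrArg (fun T : H →L[ℂ] H => T x) hSP
  have hPPx : ∀ x, P (P x) = P x := fun x => hPk _ (hP x)
  -- For normal `S` with closed range, `H` splits orthogonally into kernel and range; adding the
  -- kernel projection fills in the kernel by the identity.
  refine ⟨S + P, ?_, ⟨?_⟩, ?_⟩
  · rw [isUnit_iff_bijective]
    constructor
    · rw [injective_iff_map_eq_zero]
      intro x hx
      have hx' : S x + P x = 0 := hx
      have h1 : P x = 0 := by
        have := congrArg P hx'
        rwa [map_add, hPSx, hPPx, zero_add, map_zero] at this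
      rw [h1, add_zero] at hx'
      rw [← hPk x hx', h1]
    · intro y
      have hy : y - P y ∈ S.range := by
        rw [← hrange]; exact sub_starProjection_mem_orthogonal y
      obtain ⟨x, hx⟩ := hy
      have hx' : S x = y - P y := hx
      refine ⟨x - P x + P y, ?_⟩
      change S (x - P x + P y) + P (x - P x + P y) = y
      simp only [map_add, map_sub, hSPx, hPPx, hx']
      abel
  · have h1 : star S * P = 0 := by rw [← star_star (star S * P), star_mul, hPs, star_star, hPS,
      star_zero]
    have h2 : P * star S = 0 := by rw [← star_star (P * star S), star_mul, hPs, star_star, hSP,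
      star_zero]
    rw [star_add, hPs]
    change (star S + P) * (S + P) = (S + P) * (star S + P)
    simp only [mul_add, add_mul, h1, h2, hSP, hPS, add_zero, zero_add, hS.star_comm_self.eq]
  · rw [sub_add_cancel_left]
    refine (finiteRankIdeal H).neg_mem ?_
    rw [mem_finiteRankIdeal, LinearMap.hasFiniteRange_iff_range]
    have hle : (P : H →ₗ[ℂ] H).range ≤ S.ker := by
      rintro _ ⟨x, rfl⟩
      exact hP x
    have := Submodule.finiteDimensional_of_le hle
    exact Submodule.fg_iff_finiteDimensional _ |>.2 this

theorem IsFredholm.isWeyl_of_isStarNormal {S : H →L[ℂ] H} (hF : S.IsFredholm)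
    (hS : IsStarNormal S) : S.IsWeyl := by
  obtain ⟨U, hU, -, hSU⟩ := hF.exists_isUnit_of_isStarNormal hS
  simpa using isWeyl_add_of_isUnit hU hSU

open ENNReal NNReal in
/-- If a disc of radius `ε` about the origin avoids the essential spectrum of a normal operator,
perturbations of norm less than `ε` are Fredholm. -/
theorem isFredholm_add_of_isStarNormal {S D : H →L[ℂ] H} (hS : IsStarNormal S) {ε : ℝ}
    (hD : ‖D‖ < ε) (h : ∀ z : ℂ, ‖z‖ < ε → (S - algebraMap ℂ (H →L[ℂ] H) z).IsFredholm) :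
    (S + D).IsFredholm := by
  have hε : 0 < ε := (norm_nonneg D).trans_lt hD
  lift ε to ℝ≥0 using hε.le
  have hSF : S.IsFredholm := by simpa using h 0 (by simpa using hε)
  obtain ⟨_, ⟨u, rfl⟩, hu, hSU⟩ := hSF.exists_isUnit_of_isStarNormal hS
  have hB : IsStarNormal ((u⁻¹ : (H →L[ℂ] H)ˣ) : H →L[ℂ] H) := by
    refine ⟨?_⟩
    have h1 : Commute ((star u : (H →L[ℂ] H)ˣ) : H →L[ℂ] H) u := hu.star_comm_self
    exact (h1.units_inv_left).units_inv_right
  have hSu : toFredholmAlgebra H S = toFredholmAlgebra H u :=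
    toFredholmAlgebra_eq_iff.2 (finiteRankIdeal_le_approximableIdeal hSU)
  have hsc : toFredholmAlgebra H S * toFredholmAlgebra H (u⁻¹ : (H →L[ℂ] H)ˣ) = 1 := by
    rw [hSu, ← map_mul, Units.mul_inv, map_one]
  have hcs : toFredholmAlgebra H (u⁻¹ : (H →L[ℂ] H)ˣ) * toFredholmAlgebra H S = 1 := by
    rw [hSu, ← map_mul, Units.inv_mul, map_one]
  have hr := spectralRadius_inverse_le hsc hcs (ε := ε) fun z hz => by
    have := isFredholm_iff_isUnit.1 (h z hz)
    rwa [map_sub, AlgHom.commutes] at this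
  have hn : ‖toFredholmAlgebra H (u⁻¹ : (H →L[ℂ] H)ˣ)‖ * ε ≤ 1 := by
    have := (mul_le_mul_left (nnnorm_le_spectralRadius_of_isStarNormal hB) (ε : ℝ≥0∞)).trans hr
    exact_mod_cast this
  rw [isFredholm_iff_isUnit, map_add]
  refine isUnit_add_of_norm_mul_lt_one hsc hcs ?_
  -- The strict estimate below multiplies by this norm, which is zero when the quotient is trivial,
  -- as for finite-dimensional `H`.
  rcases (norm_nonneg (toFredholmAlgebra H (u⁻¹ : (H →L[ℂ] H)ˣ))).eq_or_lt with h0 | h0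
  · refine (norm_mul_le _ _).trans_lt ?_
    rw [← h0, zero_mul]
    exact one_pos
  · calc _ ≤ ‖toFredholmAlgebra H (u⁻¹ : (H →L[ℂ] H)ˣ)‖ * ‖toFredholmAlgebra H D‖ :=
          norm_mul_le _ _
      _ ≤ ‖toFredholmAlgebra H (u⁻¹ : (H →L[ℂ] H)ˣ)‖ * ‖D‖ := by
          gcongr; exact norm_toFredholmAlgebra_le D
      _ < ‖toFredholmAlgebra H (u⁻¹ : (H →L[ℂ] H)ˣ)‖ * ε := by gcongr
      _ ≤ 1 := hn

end Hilbert

end ContinuousLinearMap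

/-! ### Weyl criteria for single operators. -/

namespace ContinuousLinearMap

variable {X : Type*} [NormedAddCommGroup X] [NormedSpace ℂ X] [CompleteSpace X]

/-- An operator commuting with `A`, closer to `A` than the essential spectrum of `A` is to the
origin, is Weyl if `A` is. -/
theorem isWeyl_of_commute {A B : X →L[ℂ] X} (hAB : Commute A B) {ε : ℝ} (hε : ‖B - A‖ < ε)
    (h : ∀ z : ℂ, ‖z‖ < ε → (A - algebraMap ℂ (X →L[ℂ] X) z).IsWeyl) : B.IsWeyl := by
  have hA : A.IsWeyl := by simpa using h 0 (by simpa using (norm_nonneg _).trans_lt hε)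
  -- Every point of the segment is a commuting perturbation of `A` of norm below `ε`.
  have key := IsWeyl.of_path (γ := fun t : ℝ => A + (t : ℂ) • (B - A)) (by fun_prop) ?_
    (by simpa using hA)
  · simpa using key
  rintro t ⟨ht0, ht1⟩
  rw [isFredholm_iff_isUnit, map_add]
  refine Commute.isUnit_add (ε := ε) ?_ ?_ fun z hz => ?_
  · exact ((hAB.sub_right (Commute.refl A)).smul_right _).map (toFredholmAlgebra X)
  · refine (norm_toFredholmAlgebra_le _).trans_lt ?_
    rw [norm_smul, Complex.norm_real, Real.norm_of_nonneg ht0]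
    exact (mul_le_of_le_one_left (norm_nonneg _) ht1).trans_lt hε
  · have := isFredholm_iff_isUnit.1 (h z hz).1
    rwa [map_sub, AlgHom.commutes] at this

/-- If the spectrum of `A` is totally disconnected, all Fredholm translates of `A` are Weyl. -/
theorem IsFredholm.isWeyl_of_isTotallyDisconnected {A : X →L[ℂ] X}
    (hA : IsTotallyDisconnected (spectrum ℂ A)) {y : ℂ}
    (hy : (A - algebraMap ℂ (X →L[ℂ] X) y).IsFredholm) :
    (A - algebraMap ℂ (X →L[ℂ] X) y).IsWeyl := by
  refine ⟨hy, ?_⟩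
  have hc : Continuous fun z : ℂ => A - algebraMap ℂ (X →L[ℂ] X) z := by
    have := continuous_algebraMap ℂ (X →L[ℂ] X)
    fun_prop
  -- Resolvent points accumulate at `y`, and the index is locally constant there.
  obtain ⟨z, hz1, hz2⟩ := (mem_closure_iff_frequently.1 (hA.dense_compl y)).and_eventually
    (hc.continuousAt.eventually hy.eventually) |>.exists
  have hz : IsUnit (A - algebraMap ℂ (X →L[ℂ] X) z) := by
    have := (not_not.1 hz1 : IsUnit (algebraMap ℂ (X →L[ℂ] X) z - A)).neg
    rwa [neg_sub] at this
  rw [← hz2.2, (isWeyl_of_isUnit hz).2]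

end ContinuousLinearMap

/-! ### Limits of Weyl spectra of families. -/

namespace OperatorFamily

variable {𝕏 X : Type*} [TopologicalSpace 𝕏] [NormedAddCommGroup X] [NormedSpace ℂ X]

theorem isWeylFamily_iff {T : C(𝕏, X →L[ℂ] X)} : IsWeylFamily T ↔ ∀ x, (T x).IsWeyl :=
  ⟨fun h x => ⟨h.1 x, h.2 x⟩, fun h => ⟨fun x => (h x).1, fun x => (h x).2⟩⟩

theorem notMem_weylSpectrum_iff {T : C(𝕏, X →L[ℂ] X)} {z : ℂ} :
    z ∉ weylSpectrum T ↔ ∀ x, (T x - algebraMap ℂ (X →L[ℂ] X) z).IsWeyl := by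
  rw [weylSpectrum, Set.mem_ofPred_eq, not_not, isWeylFamily_iff]
  simp [Algebra.algebraMap_eq_smul_one]

theorem tendsto_apply {Tn : ℕ → C(𝕏, X →L[ℂ] X)} {T : C(𝕏, X →L[ℂ] X)}
    (hT : Tendsto Tn atTop (𝓝 T)) (x : 𝕏) : Tendsto (fun n => Tn n x) atTop (𝓝 (T x)) :=
  ((continuous_eval_const x).tendsto T).comp hT

theorem eventually_norm_sub_lt {Tn : ℕ → C(𝕏, X →L[ℂ] X)} {T : C(𝕏, X →L[ℂ] X)}
    (hT : Tendsto Tn atTop (𝓝 T)) (x : 𝕏) {ε : ℝ} (hε : 0 < ε) :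
    ∀ᶠ n in atTop, ‖T x - Tn n x‖ < ε := by
  have := (tendsto_apply hT x).eventually (Metric.ball_mem_nhds _ hε)
  simpa [dist_eq_norm, norm_sub_rev] using this

variable [CompactSpace 𝕏] [CompleteSpace X]

/-- The Weyl spectrum of a family is upper semicontinuous. -/
theorem setLimsup_weylSpectrum_subset {Tn : ℕ → C(𝕏, X →L[ℂ] X)} {T : C(𝕏, X →L[ℂ] X)}
    (hT : Tendsto Tn atTop (𝓝 T)) :
    setLimsup (fun n => weylSpectrum (Tn n)) ⊆ weylSpectrum T := by
  intro y hy
  by_contra hyT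
  have hopen : IsOpen {S : C(𝕏, X →L[ℂ] X) | IsWeylFamily S} := by
    have := ContinuousMap.isOpen_setOfPred_mapsTo (isCompact_univ (X := 𝕏))
      (ContinuousLinearMap.isOpen_setOf_isWeyl (X := X))
    have heq : {S : C(𝕏, X →L[ℂ] X) | IsWeylFamily S} =
        {S : C(𝕏, X →L[ℂ] X) | Set.MapsTo S Set.univ {A | A.IsWeyl}} := by
      ext S
      exact isWeylFamily_iff.trans ⟨fun h x _ => h x, fun h x => h (Set.mem_univ x)⟩
    rwa [heq]
  have hcont : Continuous fun p : C(𝕏, X →L[ℂ] X) × ℂ =>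
      p.1 - p.2 • (1 : C(𝕏, X →L[ℂ] X)) :=
    continuous_fst.sub (continuous_snd.smul continuous_const)
  have hev := (hcont.tendsto (T, y)).eventually
    (hopen.mem_nhds (show IsWeylFamily _ from not_not.1 hyT))
  rw [nhds_prod_eq] at hev
  obtain ⟨p, hp, q, hq, hpq⟩ := eventually_prod_iff.1 hev
  obtain ⟨n, ⟨z, hzq, hz⟩, hn⟩ := ((hy _ hq).and_eventually (hT.eventually hp)).exists
  exact hz (hpq hn hzq)

/-- A point outside the lower limit has a ball that misses the Weyl spectra for infinitely many `n`;
the ball serves all `x` at once, so the remaining condition `h` is pointwise. -/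
theorem setTendsto_weylSpectrum {Tn : ℕ → C(𝕏, X →L[ℂ] X)} {T : C(𝕏, X →L[ℂ] X)}
    (hT : Tendsto Tn atTop (𝓝 T))
    (h : ∀ (x : 𝕏) (y : ℂ) (ε : ℝ), 0 < ε →
      (∃ᶠ n in atTop, ∀ z ∈ Metric.ball y ε, (Tn n x - algebraMap ℂ (X →L[ℂ] X) z).IsWeyl) →
      (T x - algebraMap ℂ (X →L[ℂ] X) y).IsWeyl) :
    SetTendsto (fun n => weylSpectrum (Tn n)) (weylSpectrum T) := by
  have h1 := setLimsup_weylSpectrum_subset hT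
  have h2 : setLiminf (fun n => weylSpectrum (Tn n)) ⊆
      setLimsup (fun n => weylSpectrum (Tn n)) := fun y hy V hV => (hy V hV).frequently
  have h3 : weylSpectrum T ⊆ setLiminf (fun n => weylSpectrum (Tn n)) := by
    intro y hy V hV
    by_contra hfr
    refine notMem_weylSpectrum_iff.2 (fun x => ?_) hy
    obtain ⟨ε, hε, hεV⟩ := Metric.mem_nhds_iff.1 hV
    refine h x y ε hε ((not_eventually.1 hfr).mono fun n hn z hz => ?_)
    exact notMem_weylSpectrum_iff.1 (fun hz' => hn ⟨z, hεV hz, hz'⟩) x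
  exact ⟨(h2.trans h1).antisymm h3, h1.antisymm (h3.trans h2)⟩

theorem setTendsto_weylSpectrum_of_commute {Tn : ℕ → C(𝕏, X →L[ℂ] X)} {T : C(𝕏, X →L[ℂ] X)}
    (hT : Tendsto Tn atTop (𝓝 T)) (hc : ∀ n, Tn n * T = T * Tn n) :
    SetTendsto (fun n => weylSpectrum (Tn n)) (weylSpectrum T) := by
  refine setTendsto_weylSpectrum hT fun x y ε hε hfr => ?_
  obtain ⟨n, hn, hlt⟩ := (hfr.and_eventually (eventually_norm_sub_lt hT x hε)).exists
  have hcx : Commute (Tn n x) (T x) := congrArg (fun S : C(𝕏, X →L[ℂ] X) => S x) (hc n)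
  -- `T x` is viewed as a perturbation of `Tn n x`: the Weyl ball is known for `Tn n x`, and its
  -- radius `ε` is independent of `n`.
  refine ContinuousLinearMap.isWeyl_of_commute (A := Tn n x - algebraMap ℂ (X →L[ℂ] X) y)
    (ε := ε) ?_ (by rwa [sub_sub_sub_cancel_right]) fun z hz => ?_
  · exact (hcx.sub_left (Algebra.commute_algebraMap_left _ _)).sub_right
      (Algebra.commute_algebraMap_right _ _)
  · rw [sub_sub, ← map_add]
    exact hn _ (by simpa using hz)

theorem setTendsto_weylSpectrum_of_isTotallyDisconnected {Tn : ℕ → C(𝕏, X →L[ℂ] X)}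
    {T : C(𝕏, X →L[ℂ] X)} (hT : Tendsto Tn atTop (𝓝 T))
    (hd : IsTotallyDisconnected (spectrum ℂ T)) :
    SetTendsto (fun n => weylSpectrum (Tn n)) (weylSpectrum T) := by
  refine setTendsto_weylSpectrum hT fun x y ε hε hfr => ?_
  have hsub : spectrum ℂ (T x) ⊆ spectrum ℂ T := by
    intro z hz hu
    refine hz ?_
    obtain ⟨S, h1, h2⟩ := isUnit_iff_exists.1 hu
    exact isUnit_iff_exists.2 ⟨S x, congrArg (fun R : C(𝕏, X →L[ℂ] X) => R x) h1,
      congrArg (fun R : C(𝕏, X →L[ℂ] X) => R x) h2⟩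
  have hdx : IsTotallyDisconnected (spectrum ℂ (T x)) := fun t ht => hd t (ht.trans hsub)
  refine ContinuousLinearMap.IsFredholm.isWeyl_of_isTotallyDisconnected hdx ?_
  have hconv := (ContinuousLinearMap.continuous_toFredholmAlgebra.tendsto (T x)).comp
    (tendsto_apply hT x)
  -- Passing to the quotient shrinks the spectrum, so total disconnectedness survives.
  have := isUnit_of_isTotallyDisconnected_spectrum
    (fun t ht => hdx t (ht.trans (AlgHom.spectrum_apply_subset _ _))) hconv hε
    (hfr.mono fun n hn z hz => by
      have := (ContinuousLinearMap.isFredholm_iff_isUnit.1 (hn z hz).1).neg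
      rwa [map_sub, AlgHom.commutes, neg_sub] at this)
  rw [ContinuousLinearMap.isFredholm_iff_isUnit, map_sub, AlgHom.commutes]
  simpa using this.neg

theorem setTendsto_weylSpectrum_of_isStarNormal {H : Type*} [NormedAddCommGroup H]
    [InnerProductSpace ℂ H] [CompleteSpace H] {Tn : ℕ → C(𝕏, H →L[ℂ] H)} {T : C(𝕏, H →L[ℂ] H)}
    (hT : Tendsto Tn atTop (𝓝 T)) (hn : ∀ n x, IsStarNormal (Tn n x))
    (hN : ∀ x, IsStarNormal (T x)) :
    SetTendsto (fun n => weylSpectrum (Tn n)) (weylSpectrum T) := by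
  have hnorm : ∀ {A : H →L[ℂ] H} (z : ℂ), IsStarNormal A →
      IsStarNormal (A - algebraMap ℂ (H →L[ℂ] H) z) := by
    intro A z hA
    refine ⟨?_⟩
    rw [star_sub, ← algebraMap_star_comm]
    exact (hA.star_comm_self.sub_left (Algebra.commute_algebraMap_left _ _)).sub_right
      (Algebra.commute_algebraMap_right _ _)
  refine setTendsto_weylSpectrum hT fun x y ε hε hfr => ?_
  obtain ⟨n, hfn, hlt⟩ := (hfr.and_eventually (eventually_norm_sub_lt hT x hε)).exists
  refine ContinuousLinearMap.IsFredholm.isWeyl_of_isStarNormal ?_ (hnorm y (hN x))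
  have := ContinuousLinearMap.isFredholm_add_of_isStarNormal (hnorm y (hn n x)) hlt fun z hz => by
    rw [sub_sub, ← map_add]
    exact (hfn _ (by simpa using hz)).1
  rwa [show Tn n x - algebraMap ℂ (H →L[ℂ] H) y + (T x - Tn n x) =
    T x - algebraMap ℂ (H →L[ℂ] H) y by abel] at this

end OperatorFamily

theorem mainTheorem7 {𝕏 : Type*} [TopologicalSpace 𝕏] [CompactSpace 𝕏] :
    (∀ (X : Type*) [NormedAddCommGroup X] [NormedSpace ℂ X] [CompleteSpace X],
      ¬ FiniteDimensional ℂ X →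
      ∀ (Tn : ℕ → C(𝕏, X →L[ℂ] X)) (T : C(𝕏, X →L[ℂ] X)),
        Tendsto Tn atTop (𝓝 T) →
        (∀ n, Tn n * T = T * Tn n) →
        OperatorFamily.SetTendsto (fun n => OperatorFamily.weylSpectrum (Tn n))
          (OperatorFamily.weylSpectrum T)) ∧
    (∀ (X : Type*) [NormedAddCommGroup X] [NormedSpace ℂ X] [CompleteSpace X],
      ¬ FiniteDimensional ℂ X →
      ∀ (Tn : ℕ → C(𝕏, X →L[ℂ] X)) (T : C(𝕏, X →L[ℂ] X)),
        Tendsto Tn atTop (𝓝 T) →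
        IsTotallyDisconnected (spectrum ℂ T) →
        OperatorFamily.SetTendsto (fun n => OperatorFamily.weylSpectrum (Tn n))
          (OperatorFamily.weylSpectrum T)) ∧
    (∀ (H : Type*) [NormedAddCommGroup H] [InnerProductSpace ℂ H] [CompleteSpace H],
      ¬ FiniteDimensional ℂ H →
      ∀ (Tn : ℕ → C(𝕏, H →L[ℂ] H)) (T : C(𝕏, H →L[ℂ] H)),
        Tendsto Tn atTop (𝓝 T) →
        (∀ n x, IsStarNormal (Tn n x)) →
        (∀ x, IsStarNormal (T x)) →
        OperatorFamily.SetTendsto (fun n => OperatorFamily.weylSpectrum (Tn n))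
          (OperatorFamily.weylSpectrum T)) :=
  ⟨fun _ _ _ _ _ _ _ hT hc => OperatorFamily.setTendsto_weylSpectrum_of_commute hT hc,
    fun _ _ _ _ _ _ _ hT hd =>
      OperatorFamily.setTendsto_weylSpectrum_of_isTotallyDisconnected hT hd,
    fun _ _ _ _ _ _ _ hT hn hN =>
      OperatorFamily.setTendsto_weylSpectrum_of_isStarNormal hT hn hN⟩
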